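/- For $t\ge 0$ let $w_2(t)\ge 1$ denote the larger of the solutions $x>0$ of $x-\log x=1+t$ (equivalently $w_2(t)=-W_{-1}(-e^{-(1+t)})$, where $W_{-1}$ is the lower real branch of the Lambert function). Let $n\ge 1$, let $\Delta_1,\Delta_2>0$, and let $\mathcal N_2=\mathcal N(\mu_2,\Sigma_2)$ be a fixed Gaussian distribution on $\mathbb R^n$ with symmetric positive definite covariance matrix $\Sigma_2$. (i) Let $\mathcal N_1=\mathcal N(\mu_1,\Sigma_1)$ and $\mathcal N_3=\mathcal N(\mu_3,\Sigma_3)$ be Gaussian distributions on $\mathbb R^n$ with symmetric positive definite covariance matrices such that $\mathrm{KL}(\mathcal N_1\,\|\,\mathcal N_2)=\Delta_1$ and $\mathrm{KL}(\mathcal N_2\,\|\,\mathcal N_3)=\Delta_2$. Then $$\mathrm{KL}(\mathcal N_1\,\|\,\mathcal N_3)\le \tfrac12\,[w_2(2\Delta_1)-1]\,[w_2(2\Delta_2)-1]+\Delta_1+\Delta_2 ,$$ a bound that does not depend on $n$. Moreover, for every $n\times n$ real matrix $B_2$ with $\Sigma_2=B_2B_2^\top$, equality holds if and only if $\mu_1=\mu_2=\mu_3$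 and there is an orthogonal matrix $Q$ such that $$\Sigma_1=B_2Q\,\mathrm{diag}(w_2(2\Delta_1),1,\dots,1)\,Q^\top B_2^\top \quad\text{and}\quad \Sigma_3=B_2Q\,\mathrm{diag}(w_2(2\Delta_2)^{-1},1,\dots,1)\,Q^\top B_2^\top .$$ (ii) The bound is attained: for every $B_2$ with $\Sigma_2=B_2B_2^\top$ and every orthogonal matrix $Q$, the two matrices displayed above are positive definite, and the Gaussian distributions $\mathcal N_1,\mathcal N_3$ with mean $\mu_2$ and these covariance matrices satisfy $\mathrm{KL}(\mathcal N_1\,\|\,\mathcal N_2)=\Delta_1$ and $\mathrm{KL}(\mathcal N_2\,\|\,\mathcal N_3)=\Delta_2$. -/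

import Mathlib

/-- `w2 t` is the larger solution `x > 0` of `x - log x = 1 + t` (for `t ≥ 0`). -/
noncomputable def w2 (t : ℝ) : ℝ :=
  sSup {x : ℝ | 0 < x ∧ x - Real.log x = 1 + t}

/-- For `t ≥ 0` the equation does have a largest positive solution, and it is `w2 t`. -/
theorem w2_isGreatest {t : ℝ} (ht : 0 ≤ t) :
    IsGreatest {x : ℝ | 0 < x ∧ x - Real.log x = 1 + t} (w2 t) ∧ 1 ≤ w2 t := by
  have key : ∃ w : ℝ, 1 ≤ w ∧ IsGreatest {x : ℝ | 0 < x ∧ x - Real.log x = 1 + t} w := by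
    have hcont : ContinuousOn (fun x : ℝ => x - Real.log x) (Set.Icc 1 (2 * (1 + t))) := by
      refine continuousOn_id.sub (Real.continuousOn_log.mono ?_)
      intro x hx
      have h1 : (1 : ℝ) ≤ x := hx.1
      exact ne_of_gt (by linarith)
    have hle : (1 : ℝ) ≤ 2 * (1 + t) := by linarith
    have hlog2 : Real.log (2 : ℝ) ≤ 1 := by
      have := Real.log_le_sub_one_of_pos (show (0 : ℝ) < 2 by norm_num)
      linarith
    have hlog : Real.log (2 * (1 + t)) ≤ 1 + t := by
      rw [Real.log_mul (by norm_num) (by positivity)]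
      have := Real.log_le_sub_one_of_pos (show (0 : ℝ) < 1 + t by linarith)
      linarith
    have hmem : (1 + t) ∈ Set.Icc ((1 : ℝ) - Real.log 1)
        (2 * (1 + t) - Real.log (2 * (1 + t))) := by
      rw [Real.log_one]
      exact ⟨by linarith, by linarith⟩
    obtain ⟨w, hw, hweq⟩ := intermediate_value_Icc hle hcont hmem
    have hw1 : (1 : ℝ) ≤ w := hw.1
    refine ⟨w, hw1, ⟨by linarith, hweq⟩, ?_⟩
    rintro x ⟨hx0, hx⟩
    by_contra! hlt
    have hweq' : w - Real.log w = 1 + t := hweq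
    have hw0 : 0 < w := by linarith
    have hratio : x / w ≠ 1 := by
      intro h
      rw [div_eq_one_iff_eq hw0.ne'] at h
      linarith
    have h1 := Real.log_lt_sub_one_of_pos (div_pos hx0 hw0) hratio
    rw [Real.log_div hx0.ne' hw0.ne'] at h1
    have h2 : x / w - 1 ≤ x - w := by
      rw [div_sub_one hw0.ne', div_le_iff₀ hw0]
      nlinarith
    linarith
  obtain ⟨w, hw1, hw⟩ := key
  have heq : w2 t = w := hw.csSup_eq
  rw [heq]
  exact ⟨hw, hw1⟩

/-- The real branch `W₋₁` of the Lambert function: for `-1/e ≤ y < 0`, the solution `x ≤ -1` of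
`x * exp x = y`. -/
noncomputable def lambertWNegOne (y : ℝ) : ℝ :=
  sInf {x : ℝ | x ≤ -1 ∧ x * Real.exp x = y}

/-- The closed form of `w2` through the Lambert function. -/
theorem w2_eq_neg_lambertWNegOne {t : ℝ} (ht : 0 ≤ t) :
    w2 t = -lambertWNegOne (-Real.exp (-(1 + t))) := by
  obtain ⟨⟨⟨h0, h⟩, hub⟩, h1⟩ := w2_isGreatest ht
  have hl : IsLeast {x : ℝ | x ≤ -1 ∧ x * Real.exp x = -Real.exp (-(1 + t))} (-w2 t) := by
    refine ⟨⟨by linarith, ?_⟩, ?_⟩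
    · have hexp : Real.exp (-(1 + t)) = Real.exp (Real.log (w2 t)) * Real.exp (-w2 t) := by
        rw [← Real.exp_add]
        congr 1
        linarith
      rw [hexp, Real.exp_log h0]
      ring
    · rintro x ⟨hx1, hx⟩
      have hx0 : 0 < -x := by linarith
      have hlog : Real.log (-x * Real.exp x) = Real.log (Real.exp (-(1 + t))) := by
        congr 1
        linarith
      rw [Real.log_mul hx0.ne' (Real.exp_pos x).ne', Real.log_exp, Real.log_exp] at hlog
      have := hub ⟨hx0, by linarith⟩
      linarith
  have heq : lambertWNegOne (-Real.exp (-(1 + t))) = -w2 t := hl.csInf_eq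
  rw [heq, neg_neg]

/-- The `n × n` diagonal matrix `diag(a, 1, …, 1)`. -/
def diagFirst (n : ℕ) (a : ℝ) : Matrix (Fin n) (Fin n) ℝ :=
  Matrix.diagonal fun i => if (i : ℕ) = 0 then a else 1

open MeasureTheory ProbabilityTheory InformationTheory
open scoped Matrix

/-! Write G = `w2` - 1, the inverse of u ↦ u - log(1+u) on [0, ∞). An affine change of coordinates
sends N₂ to the standard Gaussian. Let A be the new covariance of N₁, C the new inverse covariance
of N₃, and a, c the new means of N₁, N₃. Then 2Δ₁ = tr A - n - log det A + |a|² and 2Δ₂ = tr C - n -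
log det C + cᵀCc. The excess 2 KL(N₁‖N₃) - 2Δ₁ - 2Δ₂ equals tr((C-1)(A-1)) + aᵀ(C-1)a - 2aᵀCc, so it
must be bounded by G(2Δ₁)G(2Δ₂) (`trace_add_dotProduct_le`).

Without means, Cauchy-Schwarz for the Frobenius product leaves the bound ‖A-1‖ ≤ G(tr A - n - log
det A), and likewise for C. On eigenvalues this is |x-1| ≤ G(x - 1 - log x) together with
superadditivity of G² (`w2_sub_one_sq_superadditive`). Strict superadditivity makes it best to spend
the whole divergence on one eigenvalue, which explains both the independence of n and the shape
diag(w, 1, …, 1).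

The mean terms are absorbed by a second Cauchy-Schwarz inequality and two growth estimates, G(t)² +
2(1+G(t))r ≤ G(t+r)² and (G(t)+s)² + 2s ≤ G(t+s)² (`add_sub_two_mul_le`). The second is strict for s
> 0, so equality forces a = 0, and then c = 0. Equality in the Frobenius inequality makes C-1 a
multiple of A-1, which gives the common orthogonal frame. -/

/-! ### Growth of the function `w2 - 1`. -/

/-- `u - log (1 + u)` is strictly increasing on `[0, ∞)`. -/
theorem lt_of_sub_log_one_add_lt {u v : ℝ} (hu : 0 ≤ u) (hv : 0 ≤ v)
    (h : u - Real.log (1 + u) < v - Real.log (1 + v)) : u < v := by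
  by_contra! hvu
  have h1 : Real.log (1 + u) - Real.log (1 + v) ≤ (1 + u) / (1 + v) - 1 := by
    rw [← Real.log_div (by positivity) (by positivity)]
    exact Real.log_le_sub_one_of_pos (by positivity)
  have h2 : (1 + u) / (1 + v) - 1 ≤ u - v := by
    rw [div_sub_one (by positivity), div_le_iff₀ (by positivity)]
    nlinarith
  linarith

theorem le_of_sub_log_one_add_le {u v : ℝ} (hu : 0 ≤ u) (hv : 0 ≤ v)
    (h : u - Real.log (1 + u) ≤ v - Real.log (1 + v)) : u ≤ v := by
  by_contra! hvu
  have h1 : Real.log (1 + u) - Real.log (1 + v) < (1 + u) / (1 + v) - 1 := by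
    rw [← Real.log_div (by positivity) (by positivity)]
    refine Real.log_lt_sub_one_of_pos (by positivity) fun h => ?_
    rw [div_eq_one_iff_eq (by positivity)] at h
    linarith
  have h2 : (1 + u) / (1 + v) - 1 ≤ u - v := by
    rw [div_sub_one (by positivity), div_le_iff₀ (by positivity)]
    nlinarith
  linarith

theorem sub_one_sub_log_nonneg {x : ℝ} (hx : 0 < x) : 0 ≤ x - 1 - Real.log x := by
  have := Real.log_le_sub_one_of_pos hx
  linarith

theorem eq_one_of_sub_one_sub_log_eq_zero {x : ℝ} (hx : 0 < x) (h : x - 1 - Real.log x = 0) :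
    x = 1 := by
  by_contra hne
  have := Real.log_lt_sub_one_of_pos hx hne
  linarith

theorem w2_sub_one_nonneg {t : ℝ} (ht : 0 ≤ t) : 0 ≤ w2 t - 1 := by
  linarith [(w2_isGreatest ht).2]

theorem w2_sub_log_w2 {t : ℝ} (ht : 0 ≤ t) : w2 t - Real.log (w2 t) = 1 + t :=
  (w2_isGreatest ht).1.1.2

theorem w2_sub_one_sub_log {t : ℝ} (ht : 0 ≤ t) :
    (w2 t - 1) - Real.log (1 + (w2 t - 1)) = t := by
  rw [add_sub_cancel]
  linarith [w2_sub_log_w2 ht]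

/-- Lower bounds for `w2` are all obtained this way: the inverse function is never handled, only u -
log(1+u) at a candidate u. -/
theorem le_w2_sub_one {u t : ℝ} (hu : 0 ≤ u) (ht : 0 ≤ t) (h : u - Real.log (1 + u) ≤ t) :
    u ≤ w2 t - 1 :=
  le_of_sub_log_one_add_le hu (w2_sub_one_nonneg ht) (by rwa [w2_sub_one_sub_log ht])

theorem lt_w2_sub_one {u t : ℝ} (hu : 0 ≤ u) (ht : 0 ≤ t) (h : u - Real.log (1 + u) < t) :
    u < w2 t - 1 :=
  lt_of_sub_log_one_add_lt hu (w2_sub_one_nonneg ht) (by rwa [w2_sub_one_sub_log ht])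

theorem w2_zero : w2 0 = 1 := by
  obtain ⟨⟨⟨h0, h⟩, -⟩, -⟩ := w2_isGreatest le_rfl
  exact eq_one_of_sub_one_sub_log_eq_zero h0 (by linarith)

theorem w2_sub_one_pos {t : ℝ} (ht : 0 < t) : 0 < w2 t - 1 :=
  lt_w2_sub_one le_rfl ht.le (by simpa using ht)

theorem w2_sub_one_mono {s t : ℝ} (hs : 0 ≤ s) (hst : s ≤ t) : w2 s - 1 ≤ w2 t - 1 :=
  le_w2_sub_one (w2_sub_one_nonneg hs) (hs.trans hst) (by rwa [w2_sub_one_sub_log hs])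

/-- The square of `w2 - 1` grows at least with slope `2 * w2`. -/
theorem w2_sub_one_sq_add_le {t r : ℝ} (ht : 0 ≤ t) (hr : 0 ≤ r) :
    (w2 t - 1) ^ 2 + 2 * w2 t * r ≤ (w2 (t + r) - 1) ^ 2 := by
  have hy := w2_sub_one_nonneg ht
  have hyt := w2_sub_one_sub_log ht
  set y := w2 t - 1 with hydef
  have hwy : w2 t = 1 + y := by simp [hydef]
  rw [hwy]
  -- The candidate z has the left side as its square, so it remains to check z - log(1+z) ≤ t + r.
  -- The relation 1 + z = (1+y)(1+e) reduces this to log(1+e) ≥ e - e²/2.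
  set z := Real.sqrt (y ^ 2 + 2 * (1 + y) * r) with hz
  have hz0 : 0 ≤ z := Real.sqrt_nonneg _
  have hzz : z ^ 2 = y ^ 2 + 2 * (1 + y) * r := Real.sq_sqrt (by positivity)
  have hyz : y ≤ z := Real.le_sqrt_of_sq_le (by nlinarith [mul_nonneg hy hr])
  have hrr : r = (z - y) * (z + y) / (2 * (1 + y)) := by field_simp; linarith
  have hlog : Real.log (1 + z) = Real.log (1 + y) + Real.log (1 + (z - y) / (1 + y)) := by
    rw [← Real.log_mul (by positivity) (by
      have : 0 ≤ (z - y) / (1 + y) := div_nonneg (by linarith) (by linarith)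
      linarith)]
    congr 1
    field_simp
    ring
  have he : 0 ≤ (z - y) / (1 + y) := div_nonneg (by linarith) (by linarith)
  set e := (z - y) / (1 + y) with hedef
  have hze : z = y + e * (1 + y) := by rw [hedef]; field_simp; ring
  have h1 := Real.le_log_one_add_of_nonneg he
  have h2 : e - e ^ 2 / 2 ≤ 2 * e / (e + 2) := by
    rw [le_div_iff₀ (by linarith)]
    nlinarith [pow_nonneg he 3]
  have h3 : r = e * (z + y) / 2 := by rw [hrr, hedef]; field_simp
  have h4 : z ≤ w2 (t + r) - 1 := by
    refine le_w2_sub_one hz0 (by linarith) ?_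
    rw [hlog, ← hyt, h3, hze]
    nlinarith [mul_nonneg hy (sq_nonneg e)]
  calc _ = z ^ 2 := hzz.symm
    _ ≤ _ := pow_le_pow_left₀ hz0 h4 2

/-- This is v < sinh v at v = log(1+x). For x = `w2 s - 1` it says that (`w2 s - 1`)² is less than 2
* `w2 s` * s, the increment that superadditivity has to beat. -/
theorem sq_lt_two_mul_one_add_mul {x : ℝ} (hx : 0 < x) :
    x ^ 2 < 2 * (1 + x) * (x - Real.log (1 + x)) := by
  have h := Real.self_lt_sinh_iff.2 (Real.log_pos (show (1 : ℝ) < 1 + x by linarith))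
  rw [Real.sinh_log (by linarith)] at h
  have h2 : (1 + x) * Real.log (1 + x) < (1 + x) * ((1 + x - (1 + x)⁻¹) / 2) :=
    mul_lt_mul_of_pos_left h (by linarith)
  have h3 : (1 + x) * ((1 + x - (1 + x)⁻¹) / 2) = ((1 + x) ^ 2 - 1) / 2 := by
    field_simp
  nlinarith

/-- `(w2 - 1) ^ 2` is strictly superadditive. -/
theorem w2_sub_one_sq_superadditive {s t : ℝ} (hs : 0 < s) (ht : 0 < t) :
    (w2 s - 1) ^ 2 + (w2 t - 1) ^ 2 < (w2 (s + t) - 1) ^ 2 := by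
  -- The slope bound is used at the larger argument, where the slope 2 * `w2 t` is at least 2 * `w2
  -- s`.
  wlog hst : s ≤ t generalizing s t
  · rw [add_comm, add_comm s t]
    exact this ht hs (by linarith)
  have h1 := w2_sub_one_sq_add_le ht.le hs.le
  have h2 := sq_lt_two_mul_one_add_mul (w2_sub_one_pos hs)
  rw [w2_sub_one_sub_log hs.le] at h2
  have h3 := w2_sub_one_mono hs.le hst
  rw [add_comm s t]
  nlinarith

theorem w2_sub_one_sq_add_sq_le {s t : ℝ} (hs : 0 ≤ s) (ht : 0 ≤ t) :
    (w2 s - 1) ^ 2 + (w2 t - 1) ^ 2 ≤ (w2 (s + t) - 1) ^ 2 := by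
  rcases hs.eq_or_lt with rfl | hs
  · simp [w2_zero]
  rcases ht.eq_or_lt with rfl | ht
  · simp [w2_zero]
  exact (w2_sub_one_sq_superadditive hs ht).le

/-- The first-order growth of `(w2 - 1 + s) ^ 2` along `s`. -/
theorem w2_sub_one_add_sq_lt {t s : ℝ} (ht : 0 ≤ t) (hs : 0 < s) :
    (w2 t - 1 + s) ^ 2 + 2 * s < (w2 (t + s) - 1) ^ 2 := by
  have hx := w2_sub_one_nonneg ht
  have hxt := w2_sub_one_sub_log ht
  have hu := w2_sub_one_nonneg (add_nonneg ht hs.le)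
  have hut := w2_sub_one_sub_log (add_nonneg ht hs.le)
  have hxu : w2 t - 1 < w2 (t + s) - 1 := lt_w2_sub_one hx (by linarith) (by linarith)
  set x := w2 t - 1
  set u := w2 (t + s) - 1
  -- Since x + s = u - δ, the claim reads 2(u-x) < 2(1+u)δ - δ². The right side increases in δ on
  -- the relevant range, so the lower bound d for δ, from log(1+e) > 2e/(e+2), suffices.
  set δ := Real.log (1 + u) - Real.log (1 + x) with hδ
  have hδ1 : 2 * (u - x) / (2 + u + x) < δ := by
    have he : 0 < (u - x) / (1 + x) := div_pos (by linarith) (by linarith)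
    have h := Real.lt_log_one_add_of_pos he
    have h2 : 1 + (u - x) / (1 + x) = (1 + u) / (1 + x) := by field_simp; ring
    rw [h2, Real.log_div (by positivity) (by positivity)] at h
    have h3 : (u - x) / (1 + x) + 2 = (2 + u + x) / (1 + x) := by field_simp; ring
    have h4 : 2 * ((u - x) / (1 + x)) / ((2 + u + x) / (1 + x)) = 2 * (u - x) / (2 + u + x) := by
      field_simp
    rwa [h3, h4] at h
  have hsδ : s = u - x - δ := by rw [hδ]; linarith
  have hδu : δ < u - x := by linarith
  set d := 2 * (u - x) / (2 + u + x) with hd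
  have hd0 : 0 < d := div_pos (by linarith) (by linarith)
  have hdeq : d * (2 + u + x) = 2 * (u - x) := by rw [hd]; field_simp
  have hd1 : 0 ≤ 2 * (1 + u) * d - d ^ 2 - 2 * (u - x) := by
    have h1 : u - x = d * (2 + u + x) / 2 := by linarith
    have h2 : 2 * (1 + u) * d - d ^ 2 - 2 * (u - x) = d * (u - x - d) := by rw [← hdeq]; ring
    rw [h2]
    exact mul_nonneg hd0.le (by linarith)
  have h5 : 2 * (1 + u) * d - d ^ 2 < 2 * (1 + u) * δ - δ ^ 2 := by
    nlinarith [mul_pos (sub_pos.2 hδ1) (show 0 < 2 * (1 + u) - δ - d by linarith)]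
  rw [hsδ]
  nlinarith

/-! ### From one eigenvalue to a whole spectrum. -/

/-- For x ≥ 1 both sides agree. For x < 1 the mirror point 2 - x is compared with x: the bound
becomes log((2-x)/x) ≥ 2(1-x), which is log(1+e) ≥ 2e/(e+2) at e = 2(1-x)/x. -/
theorem abs_sub_one_le_w2 {x : ℝ} (hx : 0 < x) : |x - 1| ≤ w2 (x - 1 - Real.log x) - 1 := by
  have hf := sub_one_sub_log_nonneg hx
  rcases le_or_gt 1 x with h | h
  · rw [abs_of_nonneg (by linarith)]
    refine le_w2_sub_one (by linarith) hf ?_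
    rw [add_sub_cancel]
  · rw [abs_of_neg (by linarith)]
    refine le_w2_sub_one (by linarith) hf ?_
    have he : 0 ≤ 2 * (1 - x) / x := by apply div_nonneg <;> linarith
    have h1 := Real.le_log_one_add_of_nonneg he
    have h2 : 1 + 2 * (1 - x) / x = (1 + -(x - 1)) / x := by field_simp; ring
    rw [h2, Real.log_div (by linarith) hx.ne'] at h1
    have h3 : 2 * (2 * (1 - x) / x) / (2 * (1 - x) / x + 2) = 2 * (1 - x) := by
      field_simp
      ring
    linarith

/-- Strictness below 1 is what excludes an exceptional eigenvalue smaller than 1 in the equality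
case. -/
theorem abs_sub_one_lt_w2 {x : ℝ} (hx : 0 < x) (h : x < 1) :
    |x - 1| < w2 (x - 1 - Real.log x) - 1 := by
  have hf := sub_one_sub_log_nonneg hx
  rw [abs_of_neg (by linarith)]
  refine lt_w2_sub_one (by linarith) hf ?_
  have he : 0 < 2 * (1 - x) / x := by apply div_pos <;> linarith
  have h1 := Real.lt_log_one_add_of_pos he
  have h2 : 1 + 2 * (1 - x) / x = (1 + -(x - 1)) / x := by field_simp; ring
  rw [h2, Real.log_div (by linarith) hx.ne'] at h1
  have h3 : 2 * (2 * (1 - x) / x) / (2 * (1 - x) / x + 2) = 2 * (1 - x) := by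
    field_simp
    ring
  linarith

theorem sq_sub_one_le_w2 {x : ℝ} (hx : 0 < x) :
    (x - 1) ^ 2 ≤ (w2 (x - 1 - Real.log x) - 1) ^ 2 := by
  rw [← sq_abs]
  exact pow_le_pow_left₀ (abs_nonneg _) (abs_sub_one_le_w2 hx) 2

theorem sum_sq_sub_one_le_w2 {ι : Type*} (I : Finset ι) {x : ι → ℝ} (hx : ∀ i, 0 < x i) :
    ∑ i ∈ I, (x i - 1) ^ 2 ≤ (w2 (∑ i ∈ I, (x i - 1 - Real.log (x i))) - 1) ^ 2 := by
  classical
  induction I using Finset.induction_on with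
  | empty => simp [w2_zero]
  | insert i I hi ih =>
    rw [Finset.sum_insert hi, Finset.sum_insert hi]
    refine le_trans (add_le_add (sq_sub_one_le_w2 (hx i)) ih) ?_
    exact w2_sub_one_sq_add_sq_le (sub_one_sub_log_nonneg (hx i))
      (Finset.sum_nonneg fun j _ => sub_one_sub_log_nonneg (hx j))

/-- In the equality case exactly one of the numbers differs from `1`. -/
theorem exists_eq_w2_of_sum_sq_eq {ι : Type*} [Fintype ι] [DecidableEq ι] {x : ι → ℝ}
    (hx : ∀ i, 0 < x i) {t : ℝ} (ht : 0 < t) (hsum : ∑ i, (x i - 1 - Real.log (x i)) = t)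
    (heq : ∑ i, (x i - 1) ^ 2 = (w2 t - 1) ^ 2) :
    ∃ i, ∀ j, x j = if j = i then w2 t else 1 := by
  obtain ⟨i, hi⟩ : ∃ i, 0 < x i - 1 - Real.log (x i) := by
    by_contra! h
    linarith [Finset.sum_nonpos fun i (_ : i ∈ Finset.univ) => h i]
  have hs := Finset.add_sum_erase Finset.univ (fun j => x j - 1 - Real.log (x j))
    (Finset.mem_univ i)
  have hq := Finset.add_sum_erase Finset.univ (fun j => (x j - 1) ^ 2) (Finset.mem_univ i)
  have hle := sum_sq_sub_one_le_w2 (Finset.univ.erase i) hx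
  have hri : 0 ≤ ∑ j ∈ Finset.univ.erase i, (x j - 1 - Real.log (x j)) :=
    Finset.sum_nonneg fun j _ => sub_one_sub_log_nonneg (hx j)
  have hxi := sq_sub_one_le_w2 (hx i)
  -- If the other indices had a positive share of the sum, strict superadditivity would contradict
  -- equality.
  have hrest : ∑ j ∈ Finset.univ.erase i, (x j - 1 - Real.log (x j)) = 0 := by
    by_contra hne
    have := w2_sub_one_sq_superadditive hi (lt_of_le_of_ne hri (Ne.symm hne))
    rw [hs, hsum] at this
    linarith
  have hone : ∀ j, j ≠ i → x j = 1 := fun j hj =>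
    eq_one_of_sub_one_sub_log_eq_zero (hx j) <|
      (Finset.sum_eq_zero_iff_of_nonneg fun j _ => sub_one_sub_log_nonneg (hx j)).1 hrest j
        (Finset.mem_erase.2 ⟨hj, Finset.mem_univ j⟩)
  have hti : x i - 1 - Real.log (x i) = t := by rw [hrest, hsum] at hs; linarith
  have hi1 : 1 ≤ x i := by
    by_contra! h
    have h1 := abs_sub_one_lt_w2 (hx i) h
    have h2 := pow_lt_pow_left₀ h1 (abs_nonneg _) two_ne_zero
    rw [hti, sq_abs] at h2
    rw [hrest, w2_zero] at hle
    linarith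
  refine ⟨i, fun j => ?_⟩
  split_ifs with h
  · subst h
    have h0 : ∑ k ∈ Finset.univ.erase j, (x k - 1) ^ 2 = 0 :=
      Finset.sum_eq_zero fun k hk => by rw [hone k (Finset.ne_of_mem_erase hk)]; ring
    rw [h0, heq, add_zero] at hq
    have := (pow_left_inj₀ (by linarith) (w2_sub_one_nonneg ht.le) two_ne_zero).1 hq
    linarith
  · exact hone j h

/-! ### The scalar inequality joining covariances and means. -/

theorem mul_add_two_mul_sq_le (a b c d : ℝ) :
    (a * b + 2 * (c * d)) ^ 2 ≤ (a ^ 2 + 2 * c ^ 2) * (b ^ 2 + 2 * d ^ 2) := by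
  nlinarith [sq_nonneg (a * d - c * b)]

/-- The scalar inequality that combines the bounds for covariances and means. -/
theorem add_sub_two_mul_le {t₁ t₂ s r X Y p q m : ℝ} (ht₁ : 0 ≤ t₁) (ht₂ : 0 ≤ t₂) (hs : 0 ≤ s)
    (hr : 0 ≤ r) (hY : 0 ≤ Y) (hXle : X ≤ w2 t₁ - 1) (hYle : Y ≤ w2 t₂ - 1)
    (hp : p ≤ X * Y) (hq : q ≤ Y * s) (hm : m ^ 2 ≤ (s + q) * r) :
    p + q - 2 * m ≤ (w2 (t₁ + s) - 1) * (w2 (t₂ + r) - 1) ∧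
      (0 < t₁ + s → 0 < t₂ + r → p + q - 2 * m = (w2 (t₁ + s) - 1) * (w2 (t₂ + r) - 1) →
        s = 0 ∧ r = 0) := by
  -- In the application p is tr((C-1)(A-1)), q is aᵀ(C-1)a and m is aᵀCc, while s = |a|² and r =
  -- cᵀCc are the shares of the means in the two divergences.
  have hx := w2_sub_one_nonneg ht₁
  have hy := w2_sub_one_nonneg ht₂
  have hG₁ := w2_sub_one_nonneg (add_nonneg ht₁ hs)
  have hG₂ := w2_sub_one_nonneg (add_nonneg ht₂ hr)
  have hs2 : (w2 t₁ - 1 + s) ^ 2 + 2 * s ≤ (w2 (t₁ + s) - 1) ^ 2 := by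
    rcases hs.eq_or_lt with rfl | hs
    · simp
    · exact (w2_sub_one_add_sq_lt ht₁ hs).le
  have hr2 : (w2 t₂ - 1) ^ 2 + 2 * (1 + (w2 t₂ - 1)) * r ≤ (w2 (t₂ + r) - 1) ^ 2 := by
    rw [add_sub_cancel]
    exact w2_sub_one_sq_add_le ht₂ hr
  have hstrict := fun h : 0 < s => w2_sub_one_add_sq_lt ht₁ h
  have hG₁pos := fun h : 0 < t₁ + s => w2_sub_one_pos h
  have hG₂pos := fun h : 0 < t₂ + r => w2_sub_one_pos h
  set x := w2 t₁ - 1 with hxdef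
  set y := w2 t₂ - 1 with hydef
  set G₁ := w2 (t₁ + s) - 1 with hG₁def
  set G₂ := w2 (t₂ + r) - 1 with hG₂def
  have hqy : q ≤ y * s := hq.trans (mul_le_mul_of_nonneg_right hYle hs)
  have hpxy : p ≤ x * y := hp.trans (mul_le_mul hXle hYle hY hx)
  have hmm : m ^ 2 ≤ s * (1 + y) * r := hm.trans (by nlinarith [mul_nonneg hs hr])
  -- the sum is at most `(x + s) * y - 2 * m`, to which the Cauchy-Schwarz inequality applies
  have hle : p + q - 2 * m ≤ (x + s) * y - 2 * m := by nlinarith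
  have hCS : ((x + s) * y - 2 * m) ^ 2 ≤ ((x + s) ^ 2 + 2 * s) * (y ^ 2 + 2 * (1 + y) * r) := by
    set k := Real.sqrt (s * (1 + y) * r) with hk
    have hk0 : 0 ≤ k := Real.sqrt_nonneg _
    have hkk : k ^ 2 = s * (1 + y) * r := Real.sq_sqrt (by positivity)
    have hmk : |m| ≤ k := Real.abs_le_sqrt hmm
    have h1 : |(x + s) * y - 2 * m| ≤ (x + s) * y + 2 * k := by
      rw [abs_le] at hmk ⊢
      have : 0 ≤ (x + s) * y := by positivity
      constructor <;> linarith
    have h2 : ((x + s) * y - 2 * m) ^ 2 ≤ ((x + s) * y + 2 * k) ^ 2 := by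
      rw [← sq_abs]
      exact pow_le_pow_left₀ (abs_nonneg _) h1 2
    refine h2.trans ?_
    -- Splitting k as α * β assigns s to the first factor and (1+y)r to the second, matching the two
    -- growth estimates.
    set α := Real.sqrt s with hα
    set β := Real.sqrt ((1 + y) * r) with hβ
    have hαα : α ^ 2 = s := Real.sq_sqrt hs
    have hββ : β ^ 2 = (1 + y) * r := Real.sq_sqrt (by positivity)
    have hkαβ : k = α * β := by rw [hk, hα, hβ, ← Real.sqrt_mul hs]; ring_nf
    have e1 : ((x + s) ^ 2 + 2 * s) * (y ^ 2 + 2 * (1 + y) * r) =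
        ((x + s) ^ 2 + 2 * α ^ 2) * (y ^ 2 + 2 * β ^ 2) := by rw [hαα, hββ]; ring
    rw [e1, hkαβ]
    exact mul_add_two_mul_sq_le _ _ _ _
  have hprod : ((x + s) ^ 2 + 2 * s) * (y ^ 2 + 2 * (1 + y) * r) ≤ (G₁ * G₂) ^ 2 := by
    rw [mul_pow]
    exact mul_le_mul hs2 hr2 (by positivity) (by positivity)
  have hfin : (x + s) * y - 2 * m ≤ G₁ * G₂ :=
    (abs_le_of_sq_le_sq' (hCS.trans hprod) (mul_nonneg hG₁ hG₂)).2
  refine ⟨hle.trans hfin, fun h1 h2 he => ?_⟩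
  -- For s > 0 the growth estimate of the first factor is strict, and positivity of G₂ carries the
  -- strictness to the product.
  have hs0 : s = 0 := by
    by_contra hne
    have hst := hstrict (lt_of_le_of_ne hs (Ne.symm hne))
    have hge : (G₁ * G₂) ^ 2 ≤ ((x + s) * y - 2 * m) ^ 2 :=
      pow_le_pow_left₀ (mul_nonneg hG₁ hG₂) (he ▸ hle) 2
    have hlt : ((x + s) ^ 2 + 2 * s) * (y ^ 2 + 2 * (1 + y) * r) < (G₁ * G₂) ^ 2 := by
      rw [mul_pow]
      calc _ ≤ ((x + s) ^ 2 + 2 * s) * G₂ ^ 2 :=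
            mul_le_mul_of_nonneg_left hr2 (by positivity)
        _ < _ := mul_lt_mul_of_pos_right hst (pow_pos (hG₂pos h2) 2)
    linarith
  refine ⟨hs0, ?_⟩
  subst hs0
  have hG₁x : G₁ = x := by rw [hG₁def, add_zero]
  have hm0 : m = 0 := by
    rw [zero_mul, zero_mul] at hmm
    exact pow_eq_zero_iff two_ne_zero |>.1 (le_antisymm hmm (sq_nonneg m))
  have hxpos : 0 < x := hG₁x ▸ hG₁pos h1
  -- With s = 0 the cross term vanishes and equality leaves x * G₂ ≤ x * y; a positive r would make
  -- G₂ exceed y.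
  have hG₂y : G₂ ≤ y := by
    rw [hm0, hG₁x] at he
    exact le_of_mul_le_mul_left (by linarith) hxpos
  by_contra hne
  have hrpos : 0 < r := lt_of_le_of_ne hr (Ne.symm hne)
  have h3 : G₂ ^ 2 ≤ y ^ 2 := pow_le_pow_left₀ hG₂ hG₂y 2
  have h4 : 0 < 2 * (1 + y) * r := by positivity
  linarith

/-! ### Frobenius and spectral estimates for matrices. -/

theorem Matrix.PosDef.isSymm_sub_one {ι : Type*} [DecidableEq ι] {A : Matrix ι ι ℝ}
    (hA : A.PosDef) : (A - 1).IsSymm := by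
  have hAT : Aᵀ = A := by
    rw [← Matrix.conjTranspose_eq_transpose_of_trivial]
    exact hA.isHermitian
  rw [Matrix.IsSymm, Matrix.transpose_sub, hAT, Matrix.transpose_one]

section
variable {ι : Type*} [Fintype ι]

theorem Matrix.trace_mul_sq_le {X Y : Matrix ι ι ℝ} (hY : Y.IsSymm) (hX : X.IsSymm) :
    (X * Y).trace ^ 2 ≤ (X * X).trace * (Y * Y).trace := by
  have h : ∀ {Z W : Matrix ι ι ℝ}, W.IsSymm →
      (Z * W).trace = ∑ p : ι × ι, Z p.1 p.2 * W p.1 p.2 := by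
    intro Z W hW
    rw [Fintype.sum_prod_type]
    simp only [Matrix.trace, Matrix.diag, Matrix.mul_apply]
    exact Finset.sum_congr rfl fun i _ => Finset.sum_congr rfl fun j _ => by rw [hW.apply]
  rw [h hY, h hX, h hY]
  simp_rw [← sq]
  exact Finset.sum_mul_sq_le_sq_mul_sq _ _ _

/-- Equality in the Cauchy-Schwarz inequality for the Frobenius product. -/
theorem Matrix.eq_smul_of_trace_mul_eq {X Y : Matrix ι ι ℝ} (hX : X.IsSymm) (hY : Y.IsSymm)
    {x y : ℝ} (hx : 0 < x) (hXX : (X * X).trace = x ^ 2) (hYY : (Y * Y).trace = y ^ 2)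
    (hYX : (Y * X).trace = x * y) : Y = (y / x) • X := by
  have h0 : ((Y - (y / x) • X)ᴴ * (Y - (y / x) • X)).trace = 0 := by
    rw [Matrix.conjTranspose_eq_transpose_of_trivial, Matrix.transpose_sub, Matrix.transpose_smul,
      hX.eq, hY.eq]
    simp only [Matrix.sub_mul, Matrix.mul_sub, Matrix.trace_sub, Matrix.smul_mul, Matrix.mul_smul,
      Matrix.trace_smul, smul_eq_mul]
    rw [Matrix.trace_mul_comm X Y, hXX, hYY, hYX]
    field_simp
    ring
  rw [Matrix.trace_conjTranspose_mul_self_eq_zero_iff] at h0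
  exact sub_eq_zero.1 h0

/-- Seen as a trace against the rank-one matrix aaᵀ, whose Frobenius norm is |a|², the quadratic
form falls under the same Cauchy-Schwarz inequality as the covariances. -/
theorem Matrix.dotProduct_mulVec_eq_trace (X : Matrix ι ι ℝ) (a : ι → ℝ) :
    a ⬝ᵥ X *ᵥ a = (X * Matrix.vecMulVec a a).trace := by
  rw [Matrix.mul_vecMulVec, Matrix.trace_vecMulVec, dotProduct_comm]

/-- The quadratic form at a + t c is a nonnegative polynomial in t, so its discriminant is at most
0. -/
theorem Matrix.PosSemidef.dotProduct_mulVec_sq_le {C : Matrix ι ι ℝ} (hC : C.PosSemidef)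
    (a c : ι → ℝ) : (a ⬝ᵥ C *ᵥ c) ^ 2 ≤ (a ⬝ᵥ C *ᵥ a) * (c ⬝ᵥ C *ᵥ c) := by
  have hsym : c ⬝ᵥ C *ᵥ a = a ⬝ᵥ C *ᵥ c := by
    have hCT : Cᵀ = C := by
      rw [← Matrix.conjTranspose_eq_transpose_of_trivial]
      exact hC.isHermitian
    rw [Matrix.dotProduct_mulVec, ← Matrix.mulVec_transpose, hCT, dotProduct_comm]
  have h := discrim_le_zero (a := c ⬝ᵥ C *ᵥ c) (b := 2 * (a ⬝ᵥ C *ᵥ c)) (c := a ⬝ᵥ C *ᵥ a) ?_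
  · rw [discrim] at h
    linarith
  · intro t
    have := hC.dotProduct_mulVec_nonneg (a + t • c)
    simp only [star_trivial, Matrix.mulVec_add, Matrix.mulVec_smul, dotProduct_add,
      add_dotProduct, smul_dotProduct, dotProduct_smul, smul_eq_mul, hsym] at this
    linarith

theorem Matrix.trace_mul_self_nonneg {X : Matrix ι ι ℝ} (hX : X.IsSymm) :
    0 ≤ (X * X).trace := by
  have := (Matrix.posSemidef_conjTranspose_mul_self X).trace_nonneg
  rwa [Matrix.conjTranspose_eq_transpose_of_trivial, hX.eq] at this

variable [DecidableEq ι]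

theorem Matrix.IsHermitian.exists_orthogonal_diagonal {A : Matrix ι ι ℝ} (hA : A.IsHermitian) :
    ∃ U ∈ Matrix.orthogonalGroup ι ℝ, A = U * Matrix.diagonal hA.eigenvalues * Uᵀ := by
  refine ⟨hA.eigenvectorUnitary, hA.eigenvectorUnitary.2, ?_⟩
  have h := hA.spectral_theorem
  rw [Unitary.conjStarAlgAut_apply] at h
  exact h

theorem Matrix.sub_one_eq_of_orthogonal {U A : Matrix ι ι ℝ} {d : ι → ℝ}
    (hU : U ∈ Matrix.orthogonalGroup ι ℝ) (hA : A = U * Matrix.diagonal d * Uᵀ) :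
    A - 1 = U * Matrix.diagonal (fun i => d i - 1) * Uᵀ := by
  have h1 : U * Uᵀ = 1 := Matrix.mem_orthogonalGroup_iff _ _ |>.1 hU
  have h2 : Matrix.diagonal (fun i => d i - 1) = Matrix.diagonal d - 1 := by
    rw [← Matrix.diagonal_one, Matrix.diagonal_sub]
  rw [h2, Matrix.mul_sub, Matrix.sub_mul, ← hA, Matrix.mul_one, h1]

theorem Matrix.trace_mul_of_orthogonal {U : Matrix ι ι ℝ} (d e : ι → ℝ)
    (hU : U ∈ Matrix.orthogonalGroup ι ℝ) :
    ((U * Matrix.diagonal d * Uᵀ) * (U * Matrix.diagonal e * Uᵀ)).trace = ∑ i, d i * e i := by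
  have h1 : Uᵀ * U = 1 := Matrix.mem_orthogonalGroup_iff' _ _ |>.1 hU
  have h2 : (U * Matrix.diagonal d * Uᵀ) * (U * Matrix.diagonal e * Uᵀ) =
      U * (Matrix.diagonal d * Matrix.diagonal e * Uᵀ) := by
    simp only [Matrix.mul_assoc]
    rw [← Matrix.mul_assoc Uᵀ U, h1, Matrix.one_mul]
  rw [h2, Matrix.trace_mul_comm, Matrix.mul_assoc, h1, Matrix.mul_one, Matrix.diagonal_mul_diagonal,
    Matrix.trace_diagonal]

theorem Matrix.IsHermitian.trace_sub_one_sq {A : Matrix ι ι ℝ} (hA : A.IsHermitian) :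
    ((A - 1) * (A - 1)).trace = ∑ i, (hA.eigenvalues i - 1) ^ 2 := by
  obtain ⟨U, hU, h⟩ := hA.exists_orthogonal_diagonal
  rw [Matrix.sub_one_eq_of_orthogonal hU h, Matrix.trace_mul_of_orthogonal _ _ hU]
  simp_rw [sq]

theorem Matrix.PosDef.trace_sub_card_sub_log_det {A : Matrix ι ι ℝ} (hA : A.PosDef) :
    A.trace - Fintype.card ι - Real.log A.det =
      ∑ i, (hA.isHermitian.eigenvalues i - 1 - Real.log (hA.isHermitian.eigenvalues i)) := by
  rw [hA.isHermitian.det_eq_prod_eigenvalues, hA.isHermitian.trace_eq_sum_eigenvalues]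
  simp only [RCLike.ofReal_real_eq_id, id]
  rw [Real.log_prod fun i _ => (hA.eigenvalues_pos i).ne', Finset.sum_sub_distrib,
    Finset.sum_sub_distrib]
  simp

theorem Matrix.PosDef.trace_sub_card_sub_log_det_nonneg {A : Matrix ι ι ℝ} (hA : A.PosDef) :
    0 ≤ A.trace - Fintype.card ι - Real.log A.det := by
  rw [hA.trace_sub_card_sub_log_det]
  exact Finset.sum_nonneg fun i _ => sub_one_sub_log_nonneg (hA.eigenvalues_pos i)

theorem Matrix.PosDef.trace_sub_one_sq_le {A : Matrix ι ι ℝ} (hA : A.PosDef) :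
    ((A - 1) * (A - 1)).trace ≤ (w2 (A.trace - Fintype.card ι - Real.log A.det) - 1) ^ 2 := by
  rw [hA.trace_sub_card_sub_log_det, hA.isHermitian.trace_sub_one_sq]
  exact sum_sq_sub_one_le_w2 _ hA.eigenvalues_pos

theorem Matrix.PosDef.exists_diagonal_of_trace_sub_one_sq_eq {A : Matrix ι ι ℝ} (hA : A.PosDef)
    {t : ℝ} (ht : 0 < t) (hAt : A.trace - Fintype.card ι - Real.log A.det = t)
    (h : ((A - 1) * (A - 1)).trace = (w2 t - 1) ^ 2) :
    ∃ U ∈ Matrix.orthogonalGroup ι ℝ, ∃ i,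
      A = U * Matrix.diagonal (fun j => if j = i then w2 t else 1) * Uᵀ := by
  obtain ⟨U, hU, hUA⟩ := hA.isHermitian.exists_orthogonal_diagonal
  rw [hA.isHermitian.trace_sub_one_sq] at h
  rw [hA.trace_sub_card_sub_log_det] at hAt
  obtain ⟨i, hi⟩ := exists_eq_w2_of_sum_sq_eq hA.eigenvalues_pos ht hAt h
  exact ⟨U, hU, i, by rwa [← funext hi]⟩

/-- The inequality for whitened parameters, with its equality case. -/
theorem trace_add_dotProduct_le {A C : Matrix ι ι ℝ} (hA : A.PosDef) (hC : C.PosDef)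
    (a c : ι → ℝ) {t₁ t₂ : ℝ} (ht₁ : 0 < t₁) (ht₂ : 0 < t₂)
    (h₁ : A.trace - Fintype.card ι - Real.log A.det + a ⬝ᵥ a = t₁)
    (h₂ : C.trace - Fintype.card ι - Real.log C.det + c ⬝ᵥ C *ᵥ c = t₂) :
    ((C - 1) * (A - 1)).trace + a ⬝ᵥ (C - 1) *ᵥ a - 2 * (a ⬝ᵥ C *ᵥ c) ≤
      (w2 t₁ - 1) * (w2 t₂ - 1) ∧
    (((C - 1) * (A - 1)).trace + a ⬝ᵥ (C - 1) *ᵥ a - 2 * (a ⬝ᵥ C *ᵥ c) =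
      (w2 t₁ - 1) * (w2 t₂ - 1) → a = 0 ∧ c = 0 ∧
        ∃ U ∈ Matrix.orthogonalGroup ι ℝ, ∃ i,
          A = U * Matrix.diagonal (fun j => if j = i then w2 t₁ else 1) * Uᵀ ∧
          C = U * Matrix.diagonal (fun j => if j = i then w2 t₂ else 1) * Uᵀ) := by
  have hAs := hA.isSymm_sub_one
  have hCs := hC.isSymm_sub_one
  have hX0 := Matrix.trace_mul_self_nonneg hAs
  have hY0 := Matrix.trace_mul_self_nonneg hCs
  have hXle := hA.trace_sub_one_sq_le
  have hYle := hC.trace_sub_one_sq_le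
  have hT₁ := hA.trace_sub_card_sub_log_det_nonneg
  have hT₂ := hC.trace_sub_card_sub_log_det_nonneg
  have hs : 0 ≤ a ⬝ᵥ a := by simpa using dotProduct_star_self_nonneg a
  have hr : 0 ≤ c ⬝ᵥ C *ᵥ c := by simpa using hC.posSemidef.dotProduct_mulVec_nonneg c
  set X := Real.sqrt ((A - 1) * (A - 1)).trace with hX
  set Y := Real.sqrt ((C - 1) * (C - 1)).trace with hY
  have hXX : X ^ 2 = ((A - 1) * (A - 1)).trace := Real.sq_sqrt hX0
  have hYY : Y ^ 2 = ((C - 1) * (C - 1)).trace := Real.sq_sqrt hY0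
  have hXn : 0 ≤ X := Real.sqrt_nonneg _
  have hYn : 0 ≤ Y := Real.sqrt_nonneg _
  have hXw : X ≤ w2 (A.trace - Fintype.card ι - Real.log A.det) - 1 :=
    (Real.sqrt_le_left (w2_sub_one_nonneg hT₁)).2 hXle
  have hYw : Y ≤ w2 (C.trace - Fintype.card ι - Real.log C.det) - 1 :=
    (Real.sqrt_le_left (w2_sub_one_nonneg hT₂)).2 hYle
  have hp : ((C - 1) * (A - 1)).trace ≤ X * Y := by
    have h := Matrix.trace_mul_sq_le hAs hCs
    rw [← hXX, ← hYY, ← mul_pow, mul_comm Y] at h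
    exact (abs_le_of_sq_le_sq' h (mul_nonneg hXn hYn)).2
  have hq : a ⬝ᵥ (C - 1) *ᵥ a ≤ Y * (a ⬝ᵥ a) := by
    have h := Matrix.trace_mul_sq_le (Matrix.transpose_vecMulVec a a) hCs
    rw [← Matrix.dotProduct_mulVec_eq_trace, ← hYY, Matrix.vecMulVec_mul_vecMulVec,
      Matrix.vecMulVec_smul, Matrix.trace_smul, Matrix.trace_vecMulVec, smul_eq_mul,
      ← sq, ← mul_pow] at h
    exact (abs_le_of_sq_le_sq' h (mul_nonneg hYn hs)).2
  have hm : (a ⬝ᵥ C *ᵥ c) ^ 2 ≤ (a ⬝ᵥ a + a ⬝ᵥ (C - 1) *ᵥ a) * (c ⬝ᵥ C *ᵥ c) := by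
    have h : a ⬝ᵥ a + a ⬝ᵥ (C - 1) *ᵥ a = a ⬝ᵥ C *ᵥ a := by
      rw [Matrix.sub_mulVec, Matrix.one_mulVec, dotProduct_sub]
      ring
    rw [h]
    exact hC.posSemidef.dotProduct_mulVec_sq_le a c
  obtain ⟨hle, heq⟩ := add_sub_two_mul_le hT₁ hT₂ hs hr hYn hXw hYw hp hq hm
  rw [h₁, h₂] at hle heq
  refine ⟨hle, fun h => ?_⟩
  obtain ⟨hs0, hr0⟩ := heq ht₁ ht₂ h
  have ha : a = 0 := dotProduct_self_eq_zero.1 hs0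
  have hc : c = 0 := by
    by_contra hne
    have := hC.dotProduct_mulVec_pos hne
    rw [star_trivial] at this
    exact this.ne' hr0
  refine ⟨ha, hc, ?_⟩
  subst ha hc
  simp only [zero_dotProduct, add_zero, mul_zero, sub_zero] at h h₁ h₂
  rw [h₁] at hXw
  rw [h₂] at hYw
  have hg₁ := w2_sub_one_pos ht₁
  have hg₂ := w2_sub_one_pos ht₂
  -- The product X * Y reaches the product of the upper bounds of its factors; as these are
  -- positive, each factor equals its bound.
  have hXeq : X = w2 t₁ - 1 := by
    refine le_antisymm hXw (le_of_mul_le_mul_right ?_ hg₂)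
    rw [← h]
    exact hp.trans (mul_le_mul_of_nonneg_left hYw hXn)
  have hYeq : Y = w2 t₂ - 1 := by
    refine le_antisymm hYw (le_of_mul_le_mul_left ?_ hg₁)
    rw [← h]
    exact hp.trans (mul_le_mul_of_nonneg_right hXw hYn)
  rw [hXeq] at hXX
  rw [hYeq] at hYY
  obtain ⟨U, hU, i, hUA⟩ := hA.exists_diagonal_of_trace_sub_one_sq_eq ht₁ h₁ hXX.symm
  refine ⟨U, hU, i, hUA, ?_⟩
  have hCA := Matrix.eq_smul_of_trace_mul_eq hAs hCs hg₁ hXX.symm hYY.symm h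
  have hC1 : C = 1 + ((w2 t₂ - 1) / (w2 t₁ - 1)) • (A - 1) := by rw [← hCA, add_sub_cancel]
  have hUU : U * Uᵀ = 1 := Matrix.mem_orthogonalGroup_iff _ _ |>.1 hU
  -- C - 1 is a multiple of A - 1, so C is diagonal in the same frame with its exceptional entry at
  -- the same index i; the ratio turns `w2 t₁ - 1` into `w2 t₂ - 1`.
  have hD : Matrix.diagonal (fun j => if j = i then w2 t₂ else 1) =
      1 + ((w2 t₂ - 1) / (w2 t₁ - 1)) •
        Matrix.diagonal (fun j => (if j = i then w2 t₁ else 1) - 1) := by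
    rw [← Matrix.diagonal_one, ← Matrix.diagonal_smul, Matrix.diagonal_add]
    congr 1
    ext j
    simp only [Pi.smul_apply, smul_eq_mul]
    split_ifs
    · field_simp
      ring
    · simp
  rw [hC1, Matrix.sub_one_eq_of_orthogonal hU hUA, hD, Matrix.mul_add, Matrix.add_mul,
    Matrix.mul_one, hUU, Matrix.mul_smul, Matrix.smul_mul]

end

/-! ### Gaussian densities and the closed form of the divergence. -/

theorem MeasureTheory.Measure.map_withDensity_comp {α β : Type*} [MeasurableSpace α]
    [MeasurableSpace β] (μ : Measure α) {g : α → β} (hg : Measurable g) {h : β → ENNReal}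
    (hh : Measurable h) :
    (μ.withDensity fun x => h (g x)).map g = (μ.map g).withDensity h := by
  ext s hs
  rw [Measure.map_apply hg hs, withDensity_apply _ (hg hs), withDensity_apply _ hs,
    setLIntegral_map hs hh hg]

-- Both measures are finite, so equality of characteristic functions is enough; the one of the
-- density is a Gaussian Fourier integral.
open Complex in
open scoped RealInnerProductSpace in
theorem ProbabilityTheory.stdGaussian_eq_withDensity (E : Type*) [NormedAddCommGroup E]
    [InnerProductSpace ℝ E] [FiniteDimensional ℝ E] [MeasurableSpace E] [BorelSpace E] :
    stdGaussian E = volume.withDensity fun x : E =>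
      ENNReal.ofReal (((2 * Real.pi) ^ (Module.finrank ℝ E / 2 : ℝ))⁻¹ *
        Real.exp (-(1 / 2) * ‖x‖ ^ 2)) := by
  have hK : (0 : ℝ) < (2 * Real.pi) ^ (Module.finrank ℝ E / 2 : ℝ) := by positivity
  -- A non-integrable function has integral 0 by convention, whereas the Gaussian integral is
  -- positive.
  have hint : Integrable (fun x : E => Real.exp (-(1 / 2) * ‖x‖ ^ 2)) := by
    by_contra h
    have h1 := GaussianFourier.integral_rexp_neg_mul_sq_norm (V := E) (b := 1 / 2) (by norm_num)
    rw [integral_undef h] at h1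
    have : (0 : ℝ) < (Real.pi / (1 / 2)) ^ (Module.finrank ℝ E / 2 : ℝ) := by positivity
    linarith
  have hmeas : Measurable fun x : E => ENNReal.ofReal
      (((2 * Real.pi) ^ (Module.finrank ℝ E / 2 : ℝ))⁻¹ * Real.exp (-(1 / 2) * ‖x‖ ^ 2)) := by
    fun_prop
  have : IsFiniteMeasure (volume.withDensity fun x : E => ENNReal.ofReal
      (((2 * Real.pi) ^ (Module.finrank ℝ E / 2 : ℝ))⁻¹ * Real.exp (-(1 / 2) * ‖x‖ ^ 2))) :=
    isFiniteMeasure_withDensity_ofReal (hint.const_mul _).2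
  apply Measure.ext_of_charFun
  ext t
  rw [charFun_stdGaussian, charFun_apply, integral_withDensity_eq_integral_toReal_smul hmeas
    (ae_of_all _ fun _ => ENNReal.ofReal_lt_top)]
  have h1 := GaussianFourier.integral_cexp_neg_mul_sq_norm_add (V := E) (b := 1 / 2)
    (by norm_num) I t
  have h2 : ∀ x : E, (ENNReal.ofReal (((2 * Real.pi) ^ (Module.finrank ℝ E / 2 : ℝ))⁻¹ *
      Real.exp (-(1 / 2) * ‖x‖ ^ 2))).toReal • cexp (⟪x, t⟫ * I) =
      ((((2 * Real.pi) ^ (Module.finrank ℝ E / 2 : ℝ))⁻¹ : ℝ) : ℂ) *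
        cexp (-(1 / 2) * ‖x‖ ^ 2 + I * ⟪t, x⟫) := by
    intro x
    rw [ENNReal.toReal_ofReal (by positivity), Complex.exp_add, real_inner_comm, real_smul]
    push_cast
    ring_nf
  simp_rw [h2]
  rw [integral_const_mul, h1]
  have h3 : ((Real.pi : ℂ) / (1 / 2)) ^ (Module.finrank ℝ E / 2 : ℂ) =
      (((2 * Real.pi) ^ (Module.finrank ℝ E / 2 : ℝ) : ℝ) : ℂ) := by
    rw [ofReal_cpow (by positivity)]
    push_cast
    congr 1
    ring
  rw [h3, ← mul_assoc, ← ofReal_mul, inv_mul_cancel₀ hK.ne', ofReal_one, one_mul, I_sq]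
  congr 1
  ring

section
variable {ι : Type*} [Fintype ι] [DecidableEq ι]

/-- The density of the multivariate Gaussian distribution with mean `μ` and covariance `S`. -/
noncomputable def gaussianDensity (μ : EuclideanSpace ℝ ι) (S : Matrix ι ι ℝ)
    (x : EuclideanSpace ℝ ι) : ℝ :=
  ((2 * Real.pi) ^ (Fintype.card ι / 2 : ℝ))⁻¹ * (Real.sqrt S.det)⁻¹ *
    Real.exp (-(1 / 2) * ((x - μ).ofLp ⬝ᵥ S⁻¹ *ᵥ (x - μ).ofLp))

theorem gaussianDensity_pos (μ : EuclideanSpace ℝ ι) {S : Matrix ι ι ℝ} (hS : S.PosDef)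
    (x : EuclideanSpace ℝ ι) : 0 < gaussianDensity μ S x := by
  have := Real.sqrt_pos.2 hS.det_pos
  unfold gaussianDensity
  positivity

@[fun_prop]
theorem measurable_gaussianDensity (μ : EuclideanSpace ℝ ι) (S : Matrix ι ι ℝ) :
    Measurable (gaussianDensity μ S) := by
  unfold gaussianDensity dotProduct Matrix.mulVec dotProduct
  fun_prop

-- The measure is the image of the standard Gaussian under x ↦ μ + R x with R the square root of S;
-- the change of variables contributes the factor 1/√(det S).
open scoped MatrixOrder in
theorem multivariateGaussian_eq_withDensity (μ : EuclideanSpace ℝ ι) {S : Matrix ι ι ℝ}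
    (hS : S.PosDef) :
    multivariateGaussian μ S =
      volume.withDensity fun x => ENNReal.ofReal (gaussianDensity μ S x) := by
  have hRR : CFC.sqrt S * CFC.sqrt S = S := CFC.sqrt_mul_sqrt_self S hS.posSemidef.nonneg
  have hRT : (CFC.sqrt S)ᵀ = CFC.sqrt S := by
    rw [← Matrix.conjTranspose_eq_transpose_of_trivial]
    exact (Matrix.nonneg_iff_posSemidef.1 (CFC.sqrt_nonneg S)).isHermitian
  rw [multivariateGaussian, stdGaussian_eq_withDensity]
  generalize CFC.sqrt S = R at hRR hRT ⊢
  have hdet : R.det * R.det = S.det := by rw [← Matrix.det_mul, hRR]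
  have hRu : IsUnit R.det := by
    refine isUnit_iff_ne_zero.2 fun h => ?_
    rw [h, zero_mul] at hdet
    exact hS.det_pos.ne hdet
  have hRSR : R * (S⁻¹ * R) = 1 := by
    rw [← hRR, Matrix.mul_inv_rev, Matrix.mul_assoc, Matrix.nonsing_inv_mul _ hRu, Matrix.mul_one,
      Matrix.mul_nonsing_inv _ hRu]
  have hmap : (volume : Measure (EuclideanSpace ℝ ι)).map
      (fun x => μ + Matrix.toEuclideanCLM (𝕜 := ℝ) R x) =
      ENNReal.ofReal (Real.sqrt S.det)⁻¹ • volume := by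
    have hL : LinearMap.det (Matrix.toEuclideanLin R) = R.det := LinearMap.det_toLpLin 2 R
    have h1 := Measure.map_linearMap_addHaar_eq_smul_addHaar
      (volume : Measure (EuclideanSpace ℝ ι)) (f := Matrix.toEuclideanLin R)
      (by rw [hL]; exact hRu.ne_zero)
    have h2 : (volume : Measure (EuclideanSpace ℝ ι)).map
        (fun x => Matrix.toEuclideanCLM (𝕜 := ℝ) R x) =
        ENNReal.ofReal (Real.sqrt S.det)⁻¹ • volume := by
      rw [hL, abs_inv, ← Real.sqrt_mul_self_eq_abs, hdet] at h1
      exact h1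
    rw [← Function.comp_def (fun y => μ + y), ← Measure.map_map (measurable_const_add μ)
      (by fun_prop), h2, Measure.map_smul, map_add_left_eq_self]
  have hdens : ∀ x : EuclideanSpace ℝ ι,
      ENNReal.ofReal (((2 * Real.pi) ^ (Module.finrank ℝ (EuclideanSpace ℝ ι) / 2 : ℝ))⁻¹ *
        Real.exp (-(1 / 2) * ‖x‖ ^ 2)) =
      (fun y => ENNReal.ofReal (Real.sqrt S.det) * ENNReal.ofReal (gaussianDensity μ S y))
        (μ + Matrix.toEuclideanCLM (𝕜 := ℝ) R x) := by
    intro x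
    have hs := Real.sqrt_pos.2 hS.det_pos
    simp only
    rw [← ENNReal.ofReal_mul hs.le, gaussianDensity, add_sub_cancel_left,
      Matrix.ofLp_toEuclideanCLM, finrank_euclideanSpace]
    have h1 : R *ᵥ x.ofLp ⬝ᵥ S⁻¹ *ᵥ R *ᵥ x.ofLp = ‖x‖ ^ 2 := by
      rw [dotProduct_comm, Matrix.dotProduct_mulVec, ← Matrix.mulVec_transpose, hRT,
        Matrix.mulVec_mulVec, Matrix.mulVec_mulVec, Matrix.mul_assoc, hRSR, Matrix.one_mulVec,
        EuclideanSpace.real_norm_sq_eq, dotProduct]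
      exact Finset.sum_congr rfl fun i _ => (sq _).symm
    rw [h1]
    congr 1
    field_simp
  simp_rw [hdens]
  rw [Measure.map_withDensity_comp _ (by fun_prop) (h := fun y =>
    ENNReal.ofReal (Real.sqrt S.det) * ENNReal.ofReal (gaussianDensity μ S y)) (by fun_prop), hmap,
    withDensity_smul_measure,
    ← withDensity_smul _ (by fun_prop)]
  congr 1
  ext x
  have hs := Real.sqrt_pos.2 hS.det_pos
  simp only [Pi.smul_apply, smul_eq_mul]
  rw [← mul_assoc, ← ENNReal.ofReal_mul (by positivity), inv_mul_cancel₀ hs.ne', ENNReal.ofReal_one,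
    one_mul]

/-- The log-likelihood ratio of two measures with positive densities. -/
theorem llr_withDensity_ofReal {α : Type*} [MeasurableSpace α] (μ : Measure α) [SigmaFinite μ]
    {f g : α → ℝ} (hf : Measurable f) (hg : Measurable g) (hf0 : ∀ x, 0 < f x)
    (hg0 : ∀ x, 0 < g x) :
    (μ.withDensity fun x => ENNReal.ofReal (f x)) ≪ (μ.withDensity fun x => ENNReal.ofReal (g x)) ∧
    llr (μ.withDensity fun x => ENNReal.ofReal (f x)) (μ.withDensity fun x => ENNReal.ofReal (g x))
      =ᵐ[μ.withDensity fun x => ENNReal.ofReal (f x)]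
      fun x => Real.log (f x) - Real.log (g x) := by
  set ν := μ.withDensity fun x => ENNReal.ofReal (g x) with hν
  have h1 : (μ.withDensity fun x => ENNReal.ofReal (f x)) =
      ν.withDensity fun x => ENNReal.ofReal (f x / g x) := by
    rw [hν, ← withDensity_mul _ (by fun_prop) (by fun_prop)]
    congr 1
    ext x
    rw [Pi.mul_apply, ← ENNReal.ofReal_mul (hg0 x).le, mul_div_cancel₀ _ (hg0 x).ne']
  rw [h1]
  have hac := withDensity_absolutelyContinuous ν fun x => ENNReal.ofReal (f x / g x)
  refine ⟨hac, ?_⟩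
  have : SigmaFinite ν := SigmaFinite.withDensity_ofReal _
  have h2 := Measure.rnDeriv_withDensity ν (f := fun x => ENNReal.ofReal (f x / g x)) (by fun_prop)
  filter_upwards [hac.ae_le h2] with x hx
  rw [llr, hx, ENNReal.toReal_ofReal (div_pos (hf0 x) (hg0 x)).le,
    Real.log_div (hf0 x).ne' (hg0 x).ne']

theorem log_gaussianDensity (μ : EuclideanSpace ℝ ι) {S : Matrix ι ι ℝ} (hS : S.PosDef)
    (x : EuclideanSpace ℝ ι) :
    Real.log (gaussianDensity μ S x) =
      -Real.log ((2 * Real.pi) ^ (Fintype.card ι / 2 : ℝ)) - 1 / 2 * Real.log S.det -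
        1 / 2 * ((x - μ).ofLp ⬝ᵥ S⁻¹ *ᵥ (x - μ).ofLp) := by
  have hs := Real.sqrt_pos.2 hS.det_pos
  rw [gaussianDensity, Real.log_mul (by positivity) (by positivity),
    Real.log_mul (by positivity) (by positivity), Real.log_inv, Real.log_inv, Real.log_exp,
    Real.log_sqrt hS.det_pos.le]
  ring

/-- The second moment of a multivariate Gaussian distribution against a quadratic form. -/
theorem integral_quadratic_multivariateGaussian (μ ν : EuclideanSpace ℝ ι) {S : Matrix ι ι ℝ}
    (hS : S.PosSemidef) (P : Matrix ι ι ℝ) :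
    Integrable (fun x : EuclideanSpace ℝ ι => (x - ν).ofLp ⬝ᵥ P *ᵥ (x - ν).ofLp)
      (multivariateGaussian μ S) ∧
    ∫ x, (x - ν).ofLp ⬝ᵥ P *ᵥ (x - ν).ofLp ∂(multivariateGaussian μ S) =
      (P * S).trace + (μ - ν).ofLp ⬝ᵥ P *ᵥ (μ - ν).ofLp := by
  have hmem : ∀ i, MemLp (fun x : EuclideanSpace ℝ ι => x i) 2 (multivariateGaussian μ S) := by
    intro i
    exact (EuclideanSpace.proj (𝕜 := ℝ) i).comp_memLp' IsGaussian.memLp_two_id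
  have hmem' : ∀ i, MemLp (fun x : EuclideanSpace ℝ ι => x i - ν i) 2
      (multivariateGaussian μ S) := fun i => (hmem i).sub (memLp_const _)
  have hint1 : ∀ i, Integrable (fun x : EuclideanSpace ℝ ι => x i) (multivariateGaussian μ S) :=
    fun i => (hmem i).integrable one_le_two
  have hmean : ∀ i, ∫ x, x i ∂(multivariateGaussian μ S) = μ i := by
    intro i
    have := (EuclideanSpace.proj (𝕜 := ℝ) i).integral_comp_comm
      (IsGaussian.integrable_id (μ := multivariateGaussian μ S))
    simpa using this
  have hmean' : ∀ i, ∫ x, (x i - ν i) ∂(multivariateGaussian μ S) = μ i - ν i := by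
    intro i
    rw [integral_sub (hint1 i) (integrable_const _), hmean i]
    simp
  have hprodint : ∀ i j, Integrable (fun x : EuclideanSpace ℝ ι => (x i - ν i) * (x j - ν j))
      (multivariateGaussian μ S) := fun i j => (hmem' i).integrable_mul (hmem' j)
  have hprod : ∀ i j, ∫ x, (x i - ν i) * (x j - ν j) ∂(multivariateGaussian μ S) =
      S i j + (μ i - ν i) * (μ j - ν j) := by
    intro i j
    have h1 := covariance_eq_sub (hmem' i) (hmem' j)
    rw [covariance_sub_const_left (hint1 i), covariance_sub_const_right (hint1 j),
      covariance_eval_multivariateGaussian hS] at h1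
    simp only [Pi.mul_apply, hmean'] at h1
    linarith
  have hexp : ∀ x : EuclideanSpace ℝ ι, (x - ν).ofLp ⬝ᵥ P *ᵥ (x - ν).ofLp =
      ∑ i, ∑ j, P i j * ((x i - ν i) * (x j - ν j)) := by
    intro x
    simp only [dotProduct, Matrix.mulVec, Finset.mul_sum, PiLp.sub_apply]
    exact Finset.sum_congr rfl fun i _ => Finset.sum_congr rfl fun j _ => by ring
  simp_rw [hexp]
  have hin : ∀ i, Integrable (fun x : EuclideanSpace ℝ ι =>
      ∑ j, P i j * ((x i - ν i) * (x j - ν j))) (multivariateGaussian μ S) := fun i =>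
    integrable_finsetSum _ fun j _ => (hprodint i j).const_mul _
  refine ⟨integrable_finsetSum _ fun i _ => hin i, ?_⟩
  rw [integral_finsetSum _ fun i _ => hin i]
  simp_rw [integral_finsetSum _ fun j _ => (hprodint _ j).const_mul _, integral_const_mul, hprod,
    mul_add, Finset.sum_add_distrib]
  congr 1
  have hST : Sᵀ = S := by
    rw [← Matrix.conjTranspose_eq_transpose_of_trivial]
    exact hS.isHermitian
  simp only [Matrix.trace, Matrix.diag, Matrix.mul_apply]
  refine Finset.sum_congr rfl fun i _ => Finset.sum_congr rfl fun j _ => ?_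
  conv_lhs => rw [← hST]
  rfl

/-- The log-likelihood ratio is a constant plus a difference of two quadratic forms, integrated
through second moments; the form of the first measure itself contributes tr(S⁻¹S) = n. -/
theorem klDiv_multivariateGaussian (μ ν : EuclideanSpace ℝ ι) {S T : Matrix ι ι ℝ}
    (hS : S.PosDef) (hT : T.PosDef) :
    klDiv (multivariateGaussian μ S) (multivariateGaussian ν T) =
      ENNReal.ofReal (1 / 2 * ((T⁻¹ * S).trace - Fintype.card ι - Real.log S.det +
        Real.log T.det + (μ - ν).ofLp ⬝ᵥ T⁻¹ *ᵥ (μ - ν).ofLp)) := by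
  obtain ⟨hac, hllr⟩ := llr_withDensity_ofReal (volume : Measure (EuclideanSpace ℝ ι))
    (measurable_gaussianDensity μ S) (measurable_gaussianDensity ν T) (gaussianDensity_pos μ hS)
    (gaussianDensity_pos ν hT)
  rw [← multivariateGaussian_eq_withDensity μ hS, ← multivariateGaussian_eq_withDensity ν hT]
    at hac hllr
  obtain ⟨hi1, he1⟩ := integral_quadratic_multivariateGaussian μ μ hS.posSemidef S⁻¹
  obtain ⟨hi2, he2⟩ := integral_quadratic_multivariateGaussian μ ν hS.posSemidef T⁻¹
  have hfun : ∀ x, Real.log (gaussianDensity μ S x) - Real.log (gaussianDensity ν T x) =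
      1 / 2 * (Real.log T.det - Real.log S.det) +
        (1 / 2 * ((x - ν).ofLp ⬝ᵥ T⁻¹ *ᵥ (x - ν).ofLp) -
          1 / 2 * ((x - μ).ofLp ⬝ᵥ S⁻¹ *ᵥ (x - μ).ofLp)) := by
    intro x
    rw [log_gaussianDensity μ hS, log_gaussianDensity ν hT]
    ring
  simp_rw [hfun] at hllr
  have hI : Integrable (fun x : EuclideanSpace ℝ ι =>
      1 / 2 * ((x - ν).ofLp ⬝ᵥ T⁻¹ *ᵥ (x - ν).ofLp) -
      1 / 2 * ((x - μ).ofLp ⬝ᵥ S⁻¹ *ᵥ (x - μ).ofLp)) (multivariateGaussian μ S) :=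
    (hi2.const_mul (1 / 2)).sub (hi1.const_mul (1 / 2))
  rw [klDiv_of_ac_of_integrable hac
    (((integrable_const _).add hI).congr hllr.symm), integral_congr_ae hllr,
    integral_add (integrable_const _) hI, integral_sub (hi2.const_mul _) (hi1.const_mul _),
    integral_const, integral_const_mul, integral_const_mul, he1, he2,
    Matrix.nonsing_inv_mul _ (Matrix.isUnit_iff_isUnit_det _ |>.1 hS.isUnit)]
  congr 1
  simp
  ring

end

/-! ### Whitening by a factor of the middle covariance. -/

/-- `ENNReal.ofReal` sends every negative number to 0, so the values can be compared as reals only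
because one of them is positive. -/
theorem ENNReal.eq_of_ofReal_eq_ofReal_of_pos {x y : ℝ} (hy : 0 < y)
    (h : ENNReal.ofReal x = ENNReal.ofReal y) : x = y := by
  have hx : 0 < x := ENNReal.ofReal_pos.1 (h ▸ ENNReal.ofReal_pos.2 hy)
  exact (ENNReal.ofReal_eq_ofReal_iff hx.le hy.le).1 h

section
variable {ι : Type*} [Fintype ι] [DecidableEq ι]

theorem Matrix.PosDef.exists_mul_transpose {S : Matrix ι ι ℝ} (hS : S.PosDef) :
    ∃ B : Matrix ι ι ℝ, S = B * Bᵀ := by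
  obtain ⟨U, -, hU⟩ := hS.isHermitian.exists_orthogonal_diagonal
  refine ⟨U * Matrix.diagonal fun i => Real.sqrt (hS.isHermitian.eigenvalues i), ?_⟩
  rw [Matrix.transpose_mul, Matrix.diagonal_transpose, Matrix.mul_assoc U,
    ← Matrix.mul_assoc (Matrix.diagonal _), Matrix.diagonal_mul_diagonal, ← Matrix.mul_assoc]
  simp_rw [Real.mul_self_sqrt (hS.eigenvalues_pos _).le]
  exact hU

theorem Matrix.PosDef.isUnit_det_of_eq_mul_transpose {S B : Matrix ι ι ℝ} (hS : S.PosDef)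
    (h : S = B * Bᵀ) : IsUnit B.det := by
  refine isUnit_iff_ne_zero.2 fun h0 => hS.det_pos.ne' ?_
  rw [h, Matrix.det_mul, h0, zero_mul]

theorem Matrix.PosDef.mul_mul_transpose {P B : Matrix ι ι ℝ} (hP : P.PosDef) (hB : IsUnit B.det) :
    (B * P * Bᵀ).PosDef := by
  have h := hP.mul_mul_conjTranspose_same (B := B)
    (Matrix.vecMul_injective_of_isUnit ((Matrix.isUnit_iff_isUnit_det B).2 hB))
  rwa [Matrix.conjTranspose_eq_transpose_of_trivial] at h

/-- The divergence in coordinates in which the two covariance matrices are `P` and `R⁻¹`. -/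
theorem klDiv_multivariateGaussian_conj {μ ν : EuclideanSpace ℝ ι} {B P R S T : Matrix ι ι ℝ}
    {v : ι → ℝ} (hB : IsUnit B.det) (hP : P.PosDef) (hR : R.PosDef) (hS : S = B * P * Bᵀ)
    (hT : T = B * R⁻¹ * Bᵀ) (hv : (μ - ν).ofLp = B *ᵥ v) :
    klDiv (multivariateGaussian μ S) (multivariateGaussian ν T) =
      ENNReal.ofReal (1 / 2 * ((R * P).trace - Fintype.card ι - Real.log P.det -
        Real.log R.det + v ⬝ᵥ R *ᵥ v)) := by
  have hBT : IsUnit (Bᵀ).det := by rwa [Matrix.det_transpose]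
  have hRu : IsUnit R.det := hR.det_pos.ne'.isUnit
  have hTinv : T⁻¹ = (Bᵀ)⁻¹ * R * B⁻¹ := by
    rw [hT, Matrix.mul_inv_rev, Matrix.mul_inv_rev, Matrix.nonsing_inv_nonsing_inv _ hRu,
      Matrix.mul_assoc]
  have hdB : B.det * B.det ≠ 0 := mul_ne_zero hB.ne_zero hB.ne_zero
  rw [klDiv_multivariateGaussian μ ν (hS ▸ hP.mul_mul_transpose hB)
    (hT ▸ hR.inv.mul_mul_transpose hB), hv, hTinv]
  have htr : ((Bᵀ)⁻¹ * R * B⁻¹ * S).trace = (R * P).trace := by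
    have h1 : (Bᵀ)⁻¹ * R * B⁻¹ * S = (Bᵀ)⁻¹ * (R * P * Bᵀ) := by
      rw [hS]
      simp only [Matrix.mul_assoc]
      rw [Matrix.nonsing_inv_mul_cancel_left _ _ hB]
    rw [h1, Matrix.trace_mul_comm, Matrix.mul_nonsing_inv_cancel_right _ _ hBT]
  have hdS : Real.log S.det = Real.log (B.det * B.det) + Real.log P.det := by
    rw [← Real.log_mul hdB hP.det_pos.ne', hS, Matrix.det_mul, Matrix.det_mul,
      Matrix.det_transpose]
    ring_nf
  have hdT : Real.log T.det = Real.log (B.det * B.det) - Real.log R.det := by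
    rw [← Real.log_div hdB hR.det_pos.ne', hT, Matrix.det_mul, Matrix.det_mul,
      Matrix.det_transpose, Matrix.det_nonsing_inv, Ring.inverse_eq_inv']
    ring_nf
  have hquad : B *ᵥ v ⬝ᵥ ((Bᵀ)⁻¹ * R * B⁻¹) *ᵥ B *ᵥ v = v ⬝ᵥ R *ᵥ v := by
    rw [Matrix.mulVec_mulVec, Matrix.nonsing_inv_mul_cancel_right _ _ hB, dotProduct_comm,
      Matrix.dotProduct_mulVec, ← Matrix.mulVec_transpose, Matrix.mulVec_mulVec,
      Matrix.mul_nonsing_inv_cancel_left _ _ hBT, dotProduct_comm]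
  rw [htr, hdS, hdT, hquad]
  congr 1
  ring

theorem Matrix.conj_mul_conj_of_orthogonal {Q : Matrix ι ι ℝ} (hQ : Q ∈ Matrix.orthogonalGroup ι ℝ)
    (D E : Matrix ι ι ℝ) : (Q * D * Qᵀ) * (Q * E * Qᵀ) = Q * (D * E) * Qᵀ := by
  have h1 : Qᵀ * Q = 1 := Matrix.mem_orthogonalGroup_iff' _ _ |>.1 hQ
  simp only [Matrix.mul_assoc]
  rw [← Matrix.mul_assoc Qᵀ Q, h1, Matrix.one_mul]

theorem Matrix.trace_conj_of_orthogonal {Q : Matrix ι ι ℝ} (hQ : Q ∈ Matrix.orthogonalGroup ι ℝ)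
    (D : Matrix ι ι ℝ) : (Q * D * Qᵀ).trace = D.trace := by
  rw [Matrix.trace_mul_cycle, Matrix.mem_orthogonalGroup_iff' _ _ |>.1 hQ, Matrix.one_mul]

theorem Matrix.isUnit_det_of_orthogonal {Q : Matrix ι ι ℝ} (hQ : Q ∈ Matrix.orthogonalGroup ι ℝ) :
    IsUnit Q.det :=
  Matrix.isUnit_det_of_right_inverse (Matrix.mem_orthogonalGroup_iff _ _ |>.1 hQ)

theorem Matrix.det_conj_of_orthogonal {Q : Matrix ι ι ℝ} (hQ : Q ∈ Matrix.orthogonalGroup ι ℝ)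
    (D : Matrix ι ι ℝ) : (Q * D * Qᵀ).det = D.det := by
  have h : Q.det * Qᵀ.det = 1 := by
    rw [← Matrix.det_mul, Matrix.mem_orthogonalGroup_iff _ _ |>.1 hQ, Matrix.det_one]
  rw [Matrix.det_mul, Matrix.det_mul, mul_right_comm, h, one_mul]

end

/-! ### The extremal covariances and the inequality for Gaussians. -/

section
variable {n : ℕ}

theorem diagFirst_mul (a b : ℝ) : diagFirst n a * diagFirst n b = diagFirst n (a * b) := by
  rw [diagFirst, diagFirst, diagFirst, Matrix.diagonal_mul_diagonal]
  congr 1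
  ext i
  split_ifs <;> simp

theorem diagFirst_one : diagFirst n 1 = 1 := by simp [diagFirst]

theorem diagFirst_posDef {a : ℝ} (ha : 0 < a) : (diagFirst n a).PosDef := by
  refine Matrix.PosDef.diagonal fun i => ?_
  split_ifs
  exacts [ha, one_pos]

theorem diagFirst_succ_eq (a : ℝ) :
    diagFirst (n + 1) a = Matrix.diagonal (Fin.cons a fun _ => 1) := by
  rw [diagFirst]
  congr 1
  ext i
  refine Fin.cases ?_ (fun j => ?_) i <;> simp

theorem diagFirst_trace (hn : 1 ≤ n) (a : ℝ) : (diagFirst n a).trace = a + n - 1 := by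
  obtain ⟨m, rfl⟩ := Nat.exists_eq_add_of_le' hn
  rw [diagFirst_succ_eq, Matrix.trace_diagonal, Fin.sum_univ_succ]
  simp [add_sub_assoc]

theorem diagFirst_det (hn : 1 ≤ n) (a : ℝ) : (diagFirst n a).det = a := by
  obtain ⟨m, rfl⟩ := Nat.exists_eq_add_of_le' hn
  rw [diagFirst_succ_eq, Matrix.det_diagonal, Fin.prod_univ_succ]
  simp

theorem conj_diagFirst_inv {Q : Matrix (Fin n) (Fin n) ℝ}
    (hQ : Q ∈ Matrix.orthogonalGroup (Fin n) ℝ) {a : ℝ} (ha : a ≠ 0) :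
    (Q * diagFirst n a * Qᵀ)⁻¹ = Q * diagFirst n a⁻¹ * Qᵀ := by
  refine Matrix.inv_eq_right_inv ?_
  rw [Matrix.conj_mul_conj_of_orthogonal hQ, diagFirst_mul, mul_inv_cancel₀ ha, diagFirst_one,
    Matrix.mul_one, Matrix.mem_orthogonalGroup_iff _ _ |>.1 hQ]

theorem conj_diagFirst_posDef {Q : Matrix (Fin n) (Fin n) ℝ}
    (hQ : Q ∈ Matrix.orthogonalGroup (Fin n) ℝ) {a : ℝ} (ha : 0 < a) :
    (Q * diagFirst n a * Qᵀ).PosDef :=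
  (diagFirst_posDef ha).mul_mul_transpose (Matrix.isUnit_det_of_orthogonal hQ)

/-- The distinguished eigenvector may be moved to the first column. -/
theorem exists_orthogonal_conj_diagFirst (hn : 1 ≤ n) {U : Matrix (Fin n) (Fin n) ℝ}
    (hU : U ∈ Matrix.orthogonalGroup (Fin n) ℝ) (i : Fin n) :
    ∃ Q ∈ Matrix.orthogonalGroup (Fin n) ℝ, ∀ a : ℝ,
      U * Matrix.diagonal (fun j => if j = i then a else 1) * Uᵀ = Q * diagFirst n a * Qᵀ := by
  set σ := Equiv.swap i ⟨0, hn⟩ with hσ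
  refine ⟨U.submatrix id σ, ?_, fun a => ?_⟩
  · rw [Matrix.mem_orthogonalGroup_iff, Matrix.transpose_submatrix, Matrix.submatrix_mul_equiv,
      Matrix.mem_orthogonalGroup_iff _ _ |>.1 hU, Matrix.submatrix_id_id]
  · have hD : diagFirst n a =
        (Matrix.diagonal (fun j => if j = i then a else 1)).submatrix σ σ := by
      rw [Matrix.submatrix_diagonal_equiv, diagFirst]
      congr 1
      ext j
      have : (j : ℕ) = 0 ↔ σ j = i := by
        rw [hσ, Equiv.swap_apply_eq_iff, Equiv.swap_apply_left, Fin.ext_iff]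
      simp only [Function.comp_apply, this]
    rw [hD, Matrix.transpose_submatrix, Matrix.submatrix_mul_equiv, Matrix.submatrix_mul_equiv,
      Matrix.submatrix_id_id]

/-- All but the first coordinate of the common frame contribute nothing. The choices b = 1 and a = 1
give the two prescribed divergences, the general case the extremal one. -/
theorem klDiv_conj_diagFirst (hn : 1 ≤ n) (μ : EuclideanSpace ℝ (Fin n))
    {B Q S T : Matrix (Fin n) (Fin n) ℝ} (hB : IsUnit B.det)
    (hQ : Q ∈ Matrix.orthogonalGroup (Fin n) ℝ) {a b : ℝ} (ha : 0 < a) (hb : 0 < b)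
    (hS : S = B * Q * diagFirst n a * Qᵀ * Bᵀ) (hT : T = B * Q * diagFirst n b⁻¹ * Qᵀ * Bᵀ) :
    klDiv (multivariateGaussian μ S) (multivariateGaussian μ T) =
      ENNReal.ofReal (1 / 2 * (a * b - 1 - Real.log a - Real.log b)) := by
  rw [klDiv_multivariateGaussian_conj hB (conj_diagFirst_posDef hQ ha) (conj_diagFirst_posDef hQ hb)
    (v := 0) (by simp only [hS, Matrix.mul_assoc])
    (by rw [conj_diagFirst_inv hQ hb.ne']; simp only [hT, Matrix.mul_assoc]) (by simp),
    Matrix.conj_mul_conj_of_orthogonal hQ, Matrix.trace_conj_of_orthogonal hQ,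
    Matrix.det_conj_of_orthogonal hQ, Matrix.det_conj_of_orthogonal hQ, diagFirst_mul,
    diagFirst_trace hn, diagFirst_det hn, diagFirst_det hn, Fintype.card_fin, zero_dotProduct]
  congr 1
  ring

/-- The relaxed triangle inequality for a fixed factorization of the middle covariance matrix. -/
theorem klDiv_multivariateGaussian_le (hn : 1 ≤ n) {Δ₁ Δ₂ : ℝ} (hΔ₁ : 0 < Δ₁) (hΔ₂ : 0 < Δ₂)
    {μ₁ μ₂ μ₃ : EuclideanSpace ℝ (Fin n)} {S₁ S₂ S₃ B : Matrix (Fin n) (Fin n) ℝ}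
    (hS₁ : S₁.PosDef) (hS₂ : S₂.PosDef) (hS₃ : S₃.PosDef) (hB : S₂ = B * Bᵀ)
    (h₁ : klDiv (multivariateGaussian μ₁ S₁) (multivariateGaussian μ₂ S₂) = ENNReal.ofReal Δ₁)
    (h₂ : klDiv (multivariateGaussian μ₂ S₂) (multivariateGaussian μ₃ S₃) = ENNReal.ofReal Δ₂) :
    klDiv (multivariateGaussian μ₁ S₁) (multivariateGaussian μ₃ S₃) ≤
        ENNReal.ofReal (1 / 2 * (w2 (2 * Δ₁) - 1) * (w2 (2 * Δ₂) - 1) + Δ₁ + Δ₂) ∧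
      (klDiv (multivariateGaussian μ₁ S₁) (multivariateGaussian μ₃ S₃) =
          ENNReal.ofReal (1 / 2 * (w2 (2 * Δ₁) - 1) * (w2 (2 * Δ₂) - 1) + Δ₁ + Δ₂) →
        μ₁ = μ₂ ∧ μ₂ = μ₃ ∧
          ∃ Q ∈ Matrix.orthogonalGroup (Fin n) ℝ,
            S₁ = B * Q * diagFirst n (w2 (2 * Δ₁)) * Qᵀ * Bᵀ ∧
            S₃ = B * Q * diagFirst n (w2 (2 * Δ₂))⁻¹ * Qᵀ * Bᵀ) := by
  have hBu := hS₂.isUnit_det_of_eq_mul_transpose hB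
  have hBTu : IsUnit (Bᵀ).det := by rwa [Matrix.det_transpose]
  have hBinv : IsUnit (B⁻¹).det := Matrix.isUnit_nonsing_inv_det _ hBu
  obtain ⟨A, hA, hSA⟩ : ∃ A : Matrix (Fin n) (Fin n) ℝ, A.PosDef ∧ S₁ = B * A * Bᵀ := by
    refine ⟨B⁻¹ * S₁ * (B⁻¹)ᵀ, hS₁.mul_mul_transpose hBinv, ?_⟩
    rw [Matrix.transpose_nonsing_inv, ← Matrix.mul_assoc,
      Matrix.nonsing_inv_mul_cancel_right _ _ hBTu,
      Matrix.mul_nonsing_inv_cancel_left _ _ hBu]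
  -- C is the inverse of the whitened covariance, because the divergences to N₃ are linear in the
  -- inverse covariance apart from the log-determinant.
  obtain ⟨C, hC, hSC⟩ : ∃ C : Matrix (Fin n) (Fin n) ℝ, C.PosDef ∧ S₃ = B * C⁻¹ * Bᵀ := by
    refine ⟨(B⁻¹ * S₃ * (B⁻¹)ᵀ)⁻¹, (hS₃.mul_mul_transpose hBinv).inv, ?_⟩
    rw [Matrix.nonsing_inv_nonsing_inv _ (hS₃.mul_mul_transpose hBinv).det_pos.ne'.isUnit,
      Matrix.transpose_nonsing_inv, ← Matrix.mul_assoc,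
      Matrix.nonsing_inv_mul_cancel_right _ _ hBTu,
      Matrix.mul_nonsing_inv_cancel_left _ _ hBu]
  obtain ⟨a, ha⟩ : ∃ a : Fin n → ℝ, (μ₁ - μ₂).ofLp = B *ᵥ a :=
    ⟨B⁻¹ *ᵥ (μ₁ - μ₂).ofLp, by
      rw [Matrix.mulVec_mulVec, Matrix.mul_nonsing_inv _ hBu, Matrix.one_mulVec]⟩
  obtain ⟨c, hc⟩ : ∃ c : Fin n → ℝ, (μ₃ - μ₂).ofLp = B *ᵥ c :=
    ⟨B⁻¹ *ᵥ (μ₃ - μ₂).ofLp, by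
      rw [Matrix.mulVec_mulVec, Matrix.mul_nonsing_inv _ hBu, Matrix.one_mulVec]⟩
  have hc' : (μ₂ - μ₃).ofLp = B *ᵥ (-c) := by
    rw [Matrix.mulVec_neg, ← hc, ← WithLp.ofLp_neg, neg_sub]
  have hac : (μ₁ - μ₃).ofLp = B *ᵥ (a - c) := by
    rw [Matrix.mulVec_sub, ← ha, ← hc]
    simp only [WithLp.ofLp_sub, sub_sub_sub_cancel_right]
  have hone : (1 : Matrix (Fin n) (Fin n) ℝ).PosDef := Matrix.PosDef.one
  rw [klDiv_multivariateGaussian_conj hBu hA hone hSA (by simpa using hB) ha] at h₁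
  rw [klDiv_multivariateGaussian_conj hBu hone hC (by simpa using hB) hSC hc'] at h₂
  have e₁ := ENNReal.eq_of_ofReal_eq_ofReal_of_pos hΔ₁ h₁
  have e₂ := ENNReal.eq_of_ofReal_eq_ofReal_of_pos hΔ₂ h₂
  simp only [Matrix.one_mul, Matrix.mul_one, Matrix.det_one, Real.log_one, Matrix.one_mulVec,
    Matrix.mulVec_neg, dotProduct_neg, neg_dotProduct, neg_neg, sub_zero] at e₁ e₂
  have hsymm : c ⬝ᵥ C *ᵥ a = a ⬝ᵥ C *ᵥ c := by
    have hCT : Cᵀ = C := by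
      rw [← Matrix.conjTranspose_eq_transpose_of_trivial]
      exact hC.isHermitian
    rw [Matrix.dotProduct_mulVec, ← Matrix.mulVec_transpose, hCT, dotProduct_comm]
  obtain ⟨hle, heq⟩ := trace_add_dotProduct_le hA hC a c (t₁ := 2 * Δ₁) (t₂ := 2 * Δ₂)
    (by linarith) (by linarith) (by linarith) (by linarith)
  -- The log-determinants and cᵀCc cancel against Δ₁ + Δ₂, leaving the excess bounded by
  -- `trace_add_dotProduct_le`.
  have hkey : 1 / 2 * ((C * A).trace - Fintype.card (Fin n) - Real.log A.det - Real.log C.det +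
      (a - c) ⬝ᵥ C *ᵥ (a - c)) = 1 / 2 * (((C - 1) * (A - 1)).trace + a ⬝ᵥ (C - 1) *ᵥ a -
        2 * (a ⬝ᵥ C *ᵥ c)) + Δ₁ + Δ₂ := by
    simp only [Matrix.mul_sub, Matrix.sub_mul, Matrix.mul_one, Matrix.one_mul, Matrix.trace_sub,
      Matrix.trace_one, Matrix.sub_mulVec, Matrix.one_mulVec, Matrix.mulVec_sub, dotProduct_sub,
      sub_dotProduct, hsymm]
    linarith
  rw [klDiv_multivariateGaussian_conj hBu hA hC hSA hSC hac, hkey]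
  refine ⟨ENNReal.ofReal_le_ofReal (by linarith), fun h => ?_⟩
  have hg₁ := w2_sub_one_pos (show 0 < 2 * Δ₁ by linarith)
  have hg₂ := w2_sub_one_pos (show 0 < 2 * Δ₂ by linarith)
  have h' := ENNReal.eq_of_ofReal_eq_ofReal_of_pos (by positivity) h
  obtain ⟨ha0, hc0, U, hU, i, hUA, hUC⟩ := heq (by linarith)
  subst ha0 hc0
  rw [Matrix.mulVec_zero, WithLp.ofLp_eq_zero, sub_eq_zero] at ha hc
  obtain ⟨Q, hQ, hQU⟩ := exists_orthogonal_conj_diagFirst hn hU i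
  rw [hQU] at hUA hUC
  refine ⟨ha, hc.symm, Q, hQ, ?_, ?_⟩
  · rw [hSA, hUA]
    simp only [Matrix.mul_assoc]
  · rw [hSC, hUC, conj_diagFirst_inv hQ (by linarith)]
    simp only [Matrix.mul_assoc]

end

theorem theorem1 (n : ℕ) (hn : 1 ≤ n) (Δ₁ Δ₂ : ℝ) (hΔ₁ : 0 < Δ₁) (hΔ₂ : 0 < Δ₂)
    (μ₂ : EuclideanSpace ℝ (Fin n)) (S₂ : Matrix (Fin n) (Fin n) ℝ) (hS₂ : S₂.PosDef) :
    -- the bound and the characterization of equality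
    (∀ (μ₁ μ₃ : EuclideanSpace ℝ (Fin n)) (S₁ S₃ : Matrix (Fin n) (Fin n) ℝ),
      S₁.PosDef → S₃.PosDef →
      klDiv (multivariateGaussian μ₁ S₁) (multivariateGaussian μ₂ S₂) = ENNReal.ofReal Δ₁ →
      klDiv (multivariateGaussian μ₂ S₂) (multivariateGaussian μ₃ S₃) = ENNReal.ofReal Δ₂ →
      klDiv (multivariateGaussian μ₁ S₁) (multivariateGaussian μ₃ S₃) ≤
          ENNReal.ofReal (1 / 2 * (w2 (2 * Δ₁) - 1) * (w2 (2 * Δ₂) - 1) + Δ₁ + Δ₂) ∧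
        ∀ B₂ : Matrix (Fin n) (Fin n) ℝ, S₂ = B₂ * B₂ᵀ →
          (klDiv (multivariateGaussian μ₁ S₁) (multivariateGaussian μ₃ S₃) =
              ENNReal.ofReal (1 / 2 * (w2 (2 * Δ₁) - 1) * (w2 (2 * Δ₂) - 1) + Δ₁ + Δ₂) ↔
            μ₁ = μ₂ ∧ μ₂ = μ₃ ∧
              ∃ Q ∈ Matrix.orthogonalGroup (Fin n) ℝ,
                S₁ = B₂ * Q * diagFirst n (w2 (2 * Δ₁)) * Qᵀ * B₂ᵀ ∧
                S₃ = B₂ * Q * diagFirst n (w2 (2 * Δ₂))⁻¹ * Qᵀ * B₂ᵀ)) ∧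
    -- the parameters of the equality case are admissible, so the bound is attained
    (∀ B₂ : Matrix (Fin n) (Fin n) ℝ, S₂ = B₂ * B₂ᵀ →
      ∀ Q ∈ Matrix.orthogonalGroup (Fin n) ℝ,
        (B₂ * Q * diagFirst n (w2 (2 * Δ₁)) * Qᵀ * B₂ᵀ).PosDef ∧
        (B₂ * Q * diagFirst n (w2 (2 * Δ₂))⁻¹ * Qᵀ * B₂ᵀ).PosDef ∧
        klDiv (multivariateGaussian μ₂ (B₂ * Q * diagFirst n (w2 (2 * Δ₁)) * Qᵀ * B₂ᵀ))
          (multivariateGaussian μ₂ S₂) = ENNReal.ofReal Δ₁ ∧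
        klDiv (multivariateGaussian μ₂ S₂)
          (multivariateGaussian μ₂ (B₂ * Q * diagFirst n (w2 (2 * Δ₂))⁻¹ * Qᵀ * B₂ᵀ)) =
            ENNReal.ofReal Δ₂) := by
  have hw₁ := w2_sub_one_pos (show 0 < 2 * Δ₁ by linarith)
  have hw₂ := w2_sub_one_pos (show 0 < 2 * Δ₂ by linarith)
  have hl₁ := w2_sub_log_w2 (show 0 ≤ 2 * Δ₁ by linarith)
  have hl₂ := w2_sub_log_w2 (show 0 ≤ 2 * Δ₂ by linarith)
  have hw₁' : 0 < w2 (2 * Δ₁) := by linarith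
  have hw₂' : 0 < w2 (2 * Δ₂) := by linarith
  refine ⟨fun μ₁ μ₃ S₁ S₃ hS₁ hS₃ h₁ h₂ => ⟨?_, fun B hB => ⟨?_, ?_⟩⟩, fun B hB Q hQ => ?_⟩
  -- The bound itself does not involve a factorization, so any one will do.
  · obtain ⟨B, hB⟩ := hS₂.exists_mul_transpose
    exact (klDiv_multivariateGaussian_le hn hΔ₁ hΔ₂ hS₁ hS₂ hS₃ hB h₁ h₂).1
  · exact (klDiv_multivariateGaussian_le hn hΔ₁ hΔ₂ hS₁ hS₂ hS₃ hB h₁ h₂).2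
  · rintro ⟨rfl, rfl, Q, hQ, rfl, rfl⟩
    -- With a - log a = 1 + 2Δ₁ and b - log b = 1 + 2Δ₂, the quantity ab - 1 - log a - log b becomes
    -- (a-1)(b-1) + 2Δ₁ + 2Δ₂.
    rw [klDiv_conj_diagFirst hn _ (hS₂.isUnit_det_of_eq_mul_transpose hB) hQ hw₁' hw₂' rfl rfl]
    congr 1
    linarith
  · have hBu := hS₂.isUnit_det_of_eq_mul_transpose hB
    have hSQ : S₂ = B * Q * diagFirst n 1 * Qᵀ * Bᵀ := by
      rw [diagFirst_one, Matrix.mul_one, Matrix.mul_assoc B,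
        Matrix.mem_orthogonalGroup_iff _ _ |>.1 hQ, Matrix.mul_one, hB]
    have hpos : ∀ {a : ℝ}, 0 < a → (B * Q * diagFirst n a * Qᵀ * Bᵀ).PosDef := by
      intro a ha
      have h := (conj_diagFirst_posDef hQ ha).mul_mul_transpose hBu
      simpa only [Matrix.mul_assoc] using h
    refine ⟨hpos hw₁', hpos (inv_pos.2 hw₂'), ?_, ?_⟩
    · rw [klDiv_conj_diagFirst hn μ₂ hBu hQ hw₁' one_pos rfl (by rwa [inv_one])]
      congr 1
      rw [Real.log_one]
      linarith
    · rw [klDiv_conj_diagFirst hn μ₂ hBu hQ one_pos hw₂' hSQ rfl]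
      congr 1
      rw [Real.log_one]
      linarith
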